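/- Conventions. For a finite group $H$ and a finite-dimensional complex $H$-module $W$, let $\mathbb C[W]^H$ be the ring of polynomial invariants, $\mathbb C[W]^H_+$ the span of its homogeneous elements of positive degree, and, for $k\ge 1$, let $\beta_k(H,W)$ be the top degree of $\mathbb C[W]^H_+/(\mathbb C[W]^H_+)^{k+1}$ and $b_k(H,W)$ the top degree of $\mathbb C[W]/(\mathbb C[W]^H_+)^k\,\mathbb C[W]$. Put $\beta_k(H)=\sup_W\beta_k(H,W)$, $b_k(H)=\sup_W b_k(H,W)$ over all finite-dimensional complex $H$-modules $W$, and omit the index $k=1$; $\beta(H)$ is the Noether number of $H$. Let $\mathsf D_k(H)$ be the supremum of the lengths of those product-one sequences over $H$ (unordered finite sequences whose terms can be ordered so that the product is $1$) that cannot be written as a product of more than $k$ minimal (i.e. irreducible) product-one sequences. Write $C_n$ for the cyclic group of order $n$. An invertible linear map of finite order is a pseudoreflection if its fixed space is a hyperplane. Statement. Let $G\le \mathrm{GL}_2(\mathbb C)$ be the group generated by the Pauli matrices $$\begin{pmatrix}0&1\\1&0\end{pmatrix},\quad \begin{pmatrix}0&-i\\ i&0\end{pmatrix},\quad \begin{pmatrix}1&0\\0&-1\end{pmatrix},$$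 and let $V=\mathbb C^2$ be its natural module. Then: 1. $G$ has order $16$, is generated by pseudoreflections, is non-abelian and is isomorphic to a semidirect product $(C_4\oplus C_2)\rtimes C_2$; it has a normal subgroup $N$ with $N\cong G/N\cong C_2\oplus C_2$. 2. $\mathbb C[x,y]^G=\mathbb C[x^4+y^4,\;x^2y^2]$ and $b(G,V)=6$; moreover $\beta(G)=b(G)+1\ge b(G,V)+1=7$. 3. $\beta(C_2\oplus C_2)=3$ and $\beta(G)\le \beta_{\beta(C_2\oplus C_2)}(C_2\oplus C_2)=\beta_3(C_2\oplus C_2)=\mathsf D_3(C_2\oplus C_2)=7$. 4. Consequently $\beta(G)=7$. -/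

import Mathlib

/-! ### Polynomial invariants of a matrix representation -/

section Invariants

variable {F : Type*} [Field F] {G : Type*} [Group G] {n : ℕ}

/-- The action of `g : G` on the polynomial ring `F[V] = F[x₁, …, xₙ]` of the `G`-module
`V = Fⁿ` given by `ρ : G → GL(n, F)`, namely the algebra map with
`g • x_j = ∑ᵢ ρ(g⁻¹)_{ji} xᵢ`. -/
noncomputable def polyAct (ρ : G →* GL (Fin n) F) (g : G) :
    MvPolynomial (Fin n) F →ₐ[F] MvPolynomial (Fin n) F :=
  MvPolynomial.aeval fun j =>
    ∑ i, MvPolynomial.C ((ρ g⁻¹ : Matrix (Fin n) (Fin n) F) j i) * MvPolynomial.X i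

/-- The ring of polynomial invariants `F[V]^G`. -/
noncomputable def invariantRing (ρ : G →* GL (Fin n) F) :
    Subalgebra F (MvPolynomial (Fin n) F) where
  carrier := {f | ∀ g, polyAct ρ g f = f}
  mul_mem' := fun ha hb g => by rw [map_mul, ha g, hb g]
  add_mem' := fun ha hb g => by rw [map_add, ha g, hb g]
  algebraMap_mem' := fun r g => (polyAct ρ g).commutes r

/-- `F[V]^G_+`, the linear span of the homogeneous invariants of positive degree. -/
noncomputable def posInvariants (ρ : G →* GL (Fin n) F) :
    Submodule F (MvPolynomial (Fin n) F) :=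
  Submodule.span F {f | f ∈ invariantRing ρ ∧ ∃ d, 0 < d ∧ f.IsHomogeneous d}

/-- `β_k(G, V)`: the top degree of the graded space `F[V]^G_+ / (F[V]^G_+)^(k+1)`, where
the power is the linear span of the products of `k + 1` elements. -/
noncomputable def noetherNumberOf (k : ℕ) (ρ : G →* GL (Fin n) F) : ℕ∞ :=
  ⨆ (d : ℕ) (_ : ∃ f ∈ posInvariants ρ, f.IsHomogeneous d ∧ f ∉ posInvariants ρ ^ (k + 1)),
    (d : ℕ∞)

/-- `b_k(G, V)`: the top degree of the graded algebra `F[V] / (F[V]^G_+)^k F[V]`. -/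
noncomputable def coinvariantDegreeOf (k : ℕ) (ρ : G →* GL (Fin n) F) : ℕ∞ :=
  ⨆ (d : ℕ) (_ : ∃ f : MvPolynomial (Fin n) F, f.IsHomogeneous d ∧
      f ∉ Ideal.span ((posInvariants ρ ^ k : Submodule F (MvPolynomial (Fin n) F)) :
        Set (MvPolynomial (Fin n) F))),
    (d : ℕ∞)

end Invariants

/-- The `k`th Noether number `β_k(G)` over `F`: the supremum of `β_k(G, W)` over all
finite-dimensional `G`-modules `W` over `F`, each written in a basis as `W = Fⁿ`. -/
noncomputable def noetherNumber (F : Type*) [Field F] (k : ℕ) (G : Type*) [Group G] : ℕ∞ :=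
  ⨆ (n : ℕ) (ρ : G →* GL (Fin n) F), noetherNumberOf k ρ

/-- `b_k(G)` over `F`: the supremum of `b_k(G, W)` over all finite-dimensional `G`-modules
`W` over `F`. -/
noncomputable def coinvariantDegree (F : Type*) [Field F] (k : ℕ) (G : Type*) [Group G] : ℕ∞ :=
  ⨆ (n : ℕ) (ρ : G →* GL (Fin n) F), coinvariantDegreeOf k ρ

/-! ### Product-one sequences and Davenport constants -/

/-- The monoid `B(G)` of product-one sequences over `G`: the multisets of elements of `G`
(written additively, as a submonoid of the free abelian monoid on `G`) that can be ordered
so that their product is `1`. -/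
def productOneMonoid (G : Type*) [Group G] : AddSubmonoid (Multiset G) where
  carrier := {S | ∃ l : List G, (l : Multiset G) = S ∧ l.prod = 1}
  zero_mem' := ⟨[], rfl, rfl⟩
  add_mem' := by
    rintro _ _ ⟨l, rfl, hl⟩ ⟨m, rfl, hm⟩
    exact ⟨l ++ m, rfl, by rw [List.prod_append, hl, hm, one_mul]⟩

/-- The set of lengths `L(a)`: all `m` such that `a` is a sum of `m` atoms of `B(G)`
(`B(G)` has no unit besides `0`, and `L(0) = {0}`). -/
def lengthSet {G : Type*} [Group G] (a : productOneMonoid G) : Set ℕ :=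
  {m | ∃ s : Multiset (productOneMonoid G),
    Multiset.card s = m ∧ (∀ u ∈ s, AddIrreducible u) ∧ s.sum = a}

/-- The (large) `k`th Davenport constant `D_k(G)`: the supremum of the lengths `|a|` of the
product-one sequences `a` over `G` with `max L(a) ≤ k`. -/
noncomputable def davenport (k : ℕ) (G : Type*) [Group G] : ℕ∞ :=
  ⨆ (a : productOneMonoid G) (_ : ∀ m ∈ lengthSet a, m ≤ k),
    (Multiset.card (a : Multiset G) : ℕ∞)

/-! ### The group generated by the Pauli matrices -/

/-- The cyclic group `C_n` with `n` elements, written multiplicatively. -/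
abbrev Cyc (n : ℕ) : Type := Multiplicative (ZMod n)

/-- A pseudoreflection: an invertible linear map of finite order whose space of fixed points
is a hyperplane. -/
def IsPseudoreflection {n : ℕ} {F : Type*} [Field F] (g : GL (Fin n) F) : Prop :=
  IsOfFinOrder g ∧ ((g : Matrix (Fin n) (Fin n) F) - 1).rank = 1

/-- The Pauli matrix `σ₁`. -/
noncomputable def pauliX : GL (Fin 2) ℂ :=
  Matrix.GeneralLinearGroup.mkOfDetNeZero !![0, 1; 1, 0] (by simp [Matrix.det_fin_two])

/-- The Pauli matrix `σ₂`. -/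
noncomputable def pauliY : GL (Fin 2) ℂ :=
  Matrix.GeneralLinearGroup.mkOfDetNeZero !![0, -Complex.I; Complex.I, 0]
    (by simp [Matrix.det_fin_two])

/-- The Pauli matrix `σ₃`. -/
noncomputable def pauliZ : GL (Fin 2) ℂ :=
  Matrix.GeneralLinearGroup.mkOfDetNeZero !![1, 0; 0, -1] (by simp [Matrix.det_fin_two])

/-- The subgroup of `GL(2, ℂ)` generated by the three Pauli matrices. -/
noncomputable def pauliGroup : Subgroup (GL (Fin 2) ℂ) :=
  Subgroup.closure {pauliX, pauliY, pauliZ}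

/-- The tautological action of the Pauli group on `ℂ²`. -/
noncomputable def pauliRep : pauliGroup →* GL (Fin 2) ℂ := pauliGroup.subtype

open MvPolynomial

section PolyAct

variable {F : Type*} [Field F] {G : Type*} [Group G] {n : ℕ} (ρ : G →* GL (Fin n) F)

lemma polyAct_X (g : G) (j : Fin n) :
    polyAct ρ g (X j) = ∑ i, C ((ρ g⁻¹ : Matrix (Fin n) (Fin n) F) j i) * X i := by
  simp [polyAct]

lemma polyAct_mul (g h : G) (p : MvPolynomial (Fin n) F) :
    polyAct ρ (g * h) p = polyAct ρ g (polyAct ρ h p) := by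
  suffices H : polyAct ρ (g * h) = (polyAct ρ g).comp (polyAct ρ h) from DFunLike.congr_fun H p
  refine MvPolynomial.algHom_ext fun j => ?_
  simp only [AlgHom.comp_apply, polyAct_X, map_sum, map_mul, mul_inv_rev, Units.val_mul,
    Matrix.mul_apply, Finset.sum_mul, Finset.mul_sum, algHom_C, algebraMap_eq, mul_assoc]
  exact Finset.sum_comm

lemma polyAct_one (p : MvPolynomial (Fin n) F) : polyAct ρ 1 p = p := by
  suffices H : polyAct ρ 1 = AlgHom.id F _ from DFunLike.congr_fun H p
  refine MvPolynomial.algHom_ext fun j => ?_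
  simp [polyAct_X, Matrix.one_apply]

lemma isHomogeneous_polyAct (g : G) {p : MvPolynomial (Fin n) F} {d : ℕ}
    (hp : p.IsHomogeneous d) : (polyAct ρ g p).IsHomogeneous d := by
  have := hp.aeval (fun j => ∑ i, C ((ρ g⁻¹ : Matrix (Fin n) (Fin n) F) j i) * X i)
    (n := 1) fun j => IsHomogeneous.sum _ _ _ fun i _ => isHomogeneous_C_mul_X _ _
  simpa [polyAct] using this

/-- The polynomials fixed by the elements of a set generating the group are invariant. -/
lemma mem_invariantRing_of_closure {S : Set G} (hS : Subgroup.closure S = ⊤)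
    {p : MvPolynomial (Fin n) F} (hp : ∀ g ∈ S, polyAct ρ g p = p) : p ∈ invariantRing ρ := by
  intro g
  have hg : g ∈ Subgroup.closure S := hS ▸ Subgroup.mem_top g
  induction hg using Subgroup.closure_induction with
  | mem x hx => exact hp x hx
  | one => exact polyAct_one ρ p
  | mul x y _ _ hx hy => rw [polyAct_mul, hy, hx]
  | inv x _ hx =>
    nth_rewrite 1 [← hx]
    rw [← polyAct_mul, inv_mul_cancel, polyAct_one]

lemma posInvariants_le_invariantRing : posInvariants ρ ≤ (invariantRing ρ).toSubmodule :=
  Submodule.span_le.2 fun _ hf => hf.1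

lemma posInvariants_pow_le_invariantRing (k : ℕ) :
    posInvariants ρ ^ k ≤ (invariantRing ρ).toSubmodule := by
  induction k with
  | zero => rw [pow_zero]; exact Submodule.one_le.2 (invariantRing ρ).one_mem
  | succ k ih =>
    rw [pow_succ]
    exact Submodule.mul_le.2 fun a ha b hb =>
      (invariantRing ρ).mul_mem (ih ha) (posInvariants_le_invariantRing ρ hb)

lemma mem_posInvariants {f : MvPolynomial (Fin n) F} {d : ℕ} (hf : f ∈ invariantRing ρ)
    (hd : 0 < d) (hfd : f.IsHomogeneous d) : f ∈ posInvariants ρ :=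
  Submodule.subset_span ⟨hf, d, hd, hfd⟩

variable (n F) in
/-- The span of the homogeneous polynomials of positive degree. -/
noncomputable def posDegree : Submodule F (MvPolynomial (Fin n) F) :=
  Submodule.span F {f | ∃ d, 0 < d ∧ f.IsHomogeneous d}

/-- The sum of the orbit of a polynomial, a multiple of its image under the Reynolds operator. -/
noncomputable def orbitSum [Fintype G] : MvPolynomial (Fin n) F →ₗ[F] MvPolynomial (Fin n) F :=
  ∑ g, (polyAct ρ g).toLinearMap

lemma orbitSum_apply [Fintype G] (p : MvPolynomial (Fin n) F) :
    orbitSum ρ p = ∑ g, polyAct ρ g p := by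
  simp [orbitSum]

lemma orbitSum_of_mem_invariantRing [Fintype G] {p : MvPolynomial (Fin n) F} (hp : p ∈ invariantRing ρ) :
    orbitSum ρ p = (Fintype.card G : F) • p := by
  rw [orbitSum_apply, Finset.sum_congr rfl fun g _ => hp g]
  simp [Nat.cast_smul_eq_nsmul]

lemma orbitSum_mem_posInvariants [Fintype G] {p : MvPolynomial (Fin n) F}
    (hp : p ∈ posDegree F n) : orbitSum ρ p ∈ posInvariants ρ := by
  suffices posDegree F n ≤ (posInvariants ρ).comap (orbitSum ρ) from this hp
  refine Submodule.span_le.2 ?_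
  rintro p ⟨d, hd, hp⟩
  rw [SetLike.mem_coe, Submodule.mem_comap, orbitSum_apply]
  refine mem_posInvariants ρ (fun h => ?_) hd
    (IsHomogeneous.sum _ _ _ fun g _ => isHomogeneous_polyAct ρ g hp)
  rw [map_sum]
  simp only [← polyAct_mul]
  exact Fintype.sum_equiv (Equiv.mulLeft h) _ _ fun g => rfl

/-- An invariant that lies in `(F[V]^G_+)^k` times the polynomials without constant term lies in
`(F[V]^G_+)^(k+1)`. -/
lemma mem_posInvariants_pow_succ [CharZero F] [Fintype G] {f : MvPolynomial (Fin n) F} {k : ℕ}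
    (hf : f ∈ invariantRing ρ) (hfk : f ∈ posInvariants ρ ^ k * posDegree F n) :
    f ∈ posInvariants ρ ^ (k + 1) := by
  have key : posInvariants ρ ^ k * posDegree F n ≤
      (posInvariants ρ ^ (k + 1)).comap (orbitSum ρ) := by
    refine Submodule.mul_le.2 fun a ha b hb => ?_
    rw [Submodule.mem_comap, pow_succ]
    have : orbitSum ρ (a * b) = a * orbitSum ρ b := by
      simp only [orbitSum_apply, map_mul, Finset.mul_sum]
      exact Finset.sum_congr rfl fun g _ => by
        rw [posInvariants_pow_le_invariantRing ρ k ha g]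
    rw [this]
    exact Submodule.mul_mem_mul ha (orbitSum_mem_posInvariants ρ hb)
  have h := key hfk
  rw [Submodule.mem_comap, orbitSum_of_mem_invariantRing ρ hf] at h
  exact (Submodule.smul_mem_iff _ (by simp)).1 h

end PolyAct

section KleinEigenspaces

/-- The characters of the Klein four-group, with values in `ℤ`. -/
def kleinChar (c : ZMod 2 × ZMod 2) (k : Cyc 2 × Cyc 2) : ℤ :=
  if c.1 * k.1.toAdd + c.2 * k.2.toAdd = 0 then 1 else -1

lemma kleinChar_mul (c : ZMod 2 × ZMod 2) (k l : Cyc 2 × Cyc 2) :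
    kleinChar c (k * l) = kleinChar c k * kleinChar c l := by
  revert c k l; decide

lemma kleinChar_one (c : ZMod 2 × ZMod 2) : kleinChar c 1 = 1 := by
  revert c; decide

lemma kleinChar_add (c d : ZMod 2 × ZMod 2) (k : Cyc 2 × Cyc 2) :
    kleinChar (c + d) k = kleinChar c k * kleinChar d k := by
  revert c d k; decide

lemma kleinChar_zero (k : Cyc 2 × Cyc 2) : kleinChar 0 k = 1 := by
  revert k; decide

lemma sum_kleinChar (k : Cyc 2 × Cyc 2) : ∑ c, kleinChar c k = if k = 1 then 4 else 0 := by
  revert k; decide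

variable {F : Type*} [Field F] {G : Type*} [Group G] {n : ℕ} (ρ : G →* GL (Fin n) F)
  (π : G →* Cyc 2 × Cyc 2)

/-- The span of the homogeneous polynomials of positive degree that transform under `G` by the
character `c` of the Klein four-group, pulled back along `π`. -/
noncomputable def posEigen (c : ZMod 2 × ZMod 2) : Submodule F (MvPolynomial (Fin n) F) :=
  Submodule.span F {f | (∀ g, polyAct ρ g f = (kleinChar c (π g) : F) • f) ∧
    ∃ d, 0 < d ∧ f.IsHomogeneous d}

lemma posEigen_zero : posEigen ρ π 0 = posInvariants ρ := by
  simp only [posEigen, posInvariants, kleinChar_zero, Int.cast_one, one_smul]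
  rfl

lemma posEigen_mul_le (c d : ZMod 2 × ZMod 2) :
    posEigen ρ π c * posEigen ρ π d ≤ posEigen ρ π (c + d) := by
  rw [posEigen, posEigen, Submodule.span_mul_span]
  refine Submodule.span_mono ?_
  rintro _ ⟨p, ⟨hp, a, ha, hpa⟩, q, ⟨hq, b, hb, hqb⟩, rfl⟩
  refine ⟨fun g => ?_, a + b, by omega, hpa.mul hqb⟩
  simp only
  rw [map_mul, hp, hq, kleinChar_add, smul_mul_smul_comm, Int.cast_mul]

lemma iSup_posEigen_le_posDegree : ⨆ c, posEigen ρ π c ≤ posDegree F n :=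
  iSup_le fun _ => Submodule.span_mono fun _ hf => hf.2

lemma iSup_posEigen_mul_self_le :
    (⨆ c, posEigen ρ π c) * (⨆ c, posEigen ρ π c) ≤ ⨆ c, posEigen ρ π c := by
  simp only [Submodule.iSup_mul, Submodule.mul_iSup]
  exact iSup_le fun i => iSup_le fun j => (posEigen_mul_le ρ π _ _).trans (le_iSup (posEigen ρ π) _)

/-- Positive invariants of the kernel of a map to the Klein four-group decompose into
eigenvectors. -/
lemma posInvariants_ker_le [CharZero F] [Fintype G] :
    posInvariants (ρ.comp π.ker.subtype) ≤ ⨆ c, posEigen ρ π c := by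
  classical
  refine Submodule.span_le.2 ?_
  rintro p ⟨hp, d, hd, hpd⟩
  have hfix : ∀ g, π g = 1 → polyAct ρ g p = p := fun g hg => hp ⟨g, hg⟩
  have hsum : ∑ c, ∑ g, (kleinChar c (π g) : F) • polyAct ρ g p =
      ((Finset.univ.filter fun g => π g = 1).card * 4 : F) • p := by
    rw [Finset.sum_comm]
    simp only [← Finset.sum_smul, ← Int.cast_sum, sum_kleinChar]
    rw [Finset.card_filter, Nat.cast_sum, Finset.sum_mul, Finset.sum_smul]
    refine Finset.sum_congr rfl fun g _ => ?_
    split_ifs with hg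
    · rw [hfix g hg]; simp
    · simp
  have hne : ((Finset.univ.filter fun g => π g = 1).card * 4 : F) ≠ 0 := by
    refine mul_ne_zero (Nat.cast_ne_zero.2 (Finset.card_ne_zero_of_mem (a := 1) ?_)) (by norm_num)
    simp
  refine (Submodule.smul_mem_iff _ hne).1 ?_
  rw [← hsum]
  refine Submodule.sum_mem _ fun c _ => Submodule.mem_iSup_of_mem c (Submodule.subset_span
    ⟨fun h => ?_, d, hd, IsHomogeneous.sum _ _ _ fun g _ => ?_⟩)
  · simp only [map_sum, map_smul, ← polyAct_mul, Finset.smul_sum, smul_smul]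
    refine Fintype.sum_equiv (Equiv.mulLeft h) _ _ fun g => ?_
    simp only [Equiv.coe_mulLeft, map_mul, ← Int.cast_mul, ← kleinChar_mul]
    congr 3
    generalize π h = k
    generalize π g = l
    revert k l c
    decide
  · exact (homogeneousSubmodule (Fin n) F d).smul_mem _ (isHomogeneous_polyAct ρ g hpd)

/-- Among four elements of the Klein four-group one is trivial or two are equal. -/
lemma iSup_posEigen_pow_four_le :
    (⨆ c, posEigen ρ π c) ^ 4 ≤ posInvariants ρ * (⨆ c, posEigen ρ π c) ^ 2 := by
  have hle := fun c => le_iSup (posEigen ρ π) c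
  have hPP := iSup_posEigen_mul_self_le ρ π
  have h0 : ∀ c, posEigen ρ π c * posEigen ρ π c ≤ posInvariants ρ := fun c => by
    rw [← posEigen_zero ρ π]
    convert posEigen_mul_le ρ π c c
    revert c; decide
  have hz := posEigen_zero ρ π
  set P := ⨆ c, posEigen ρ π c with hP
  have h1 : ∀ j k l, posInvariants ρ * (posEigen ρ π j * posEigen ρ π k * posEigen ρ π l) ≤
      posInvariants ρ * P ^ 2 := fun j k l => by
    rw [pow_two]
    gcongr
    · exact (mul_le_mul' (hle j) (hle k)).trans hPP
    · exact hle l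
  have h2 : ∀ c k l, (posEigen ρ π c * posEigen ρ π c) * (posEigen ρ π k * posEigen ρ π l) ≤
      posInvariants ρ * P ^ 2 := fun c k l => by
    rw [pow_two]
    exact mul_le_mul' (h0 c) (mul_le_mul' (hle k) (hle l))
  have h4 : P ^ 4 = P * P * P * P := by ring
  rw [h4]
  nth_rewrite 1 2 3 4 [hP]
  simp only [Submodule.iSup_mul, Submodule.mul_iSup]
  refine iSup_le fun i => iSup_le fun j => iSup_le fun k => iSup_le fun l => ?_
  have : i = 0 ∨ j = 0 ∨ k = 0 ∨ l = 0 ∨ i = j ∨ i = k ∨ i = l ∨ j = k ∨ j = l ∨ k = l := by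
    revert i j k l; decide
  rcases this with rfl | rfl | rfl | rfl | rfl | rfl | rfl | rfl | rfl | rfl
  · exact le_of_eq_of_le (by rw [hz]; ring) (h1 j k l)
  · exact le_of_eq_of_le (by rw [hz]; ring) (h1 i k l)
  · exact le_of_eq_of_le (by rw [hz]; ring) (h1 i j l)
  · exact le_of_eq_of_le (by rw [hz]; ring) (h1 i j k)
  · exact le_of_eq_of_le (by ring) (h2 i k l)
  · exact le_of_eq_of_le (by ring) (h2 i j l)
  · exact le_of_eq_of_le (by ring) (h2 i j k)
  · exact le_of_eq_of_le (by ring) (h2 j i l)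
  · exact le_of_eq_of_le (by ring) (h2 j i k)
  · exact le_of_eq_of_le (by ring) (h2 k i j)

/-- Any three elements of the Klein four-group have a nonempty subsequence of product one. -/
lemma iSup_posEigen_pow_three_le :
    (⨆ c, posEigen ρ π c) ^ 3 ≤ posInvariants ρ * ⊤ := by
  have h0 : ∀ i j, i + j = 0 → posEigen ρ π i * posEigen ρ π j ≤ posInvariants ρ :=
    fun i j h => by
      rw [← posEigen_zero ρ π, ← h]
      exact posEigen_mul_le ρ π i j
  have hz := posEigen_zero ρ π
  set P := ⨆ c, posEigen ρ π c with hP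
  have h3 : P ^ 3 = P * P * P := by ring
  rw [h3]
  nth_rewrite 1 2 3 [hP]
  simp only [Submodule.iSup_mul, Submodule.mul_iSup]
  refine iSup_le fun i => iSup_le fun j => iSup_le fun k => ?_
  have : i = 0 ∨ j = 0 ∨ k = 0 ∨ i + j = 0 ∨ i + k = 0 ∨ j + k = 0 ∨ (i + j) + k = 0 := by
    revert i j k; decide
  rcases this with rfl | rfl | rfl | h | h | h | h
  · exact le_of_eq_of_le (by rw [hz]; ring) (mul_le_mul' le_rfl
      (le_top : posEigen ρ π j * posEigen ρ π k ≤ ⊤))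
  · exact le_of_eq_of_le (by rw [hz]; ring) (mul_le_mul' le_rfl
      (le_top : posEigen ρ π i * posEigen ρ π k ≤ ⊤))
  · exact le_of_eq_of_le (by rw [hz]; ring) (mul_le_mul' le_rfl
      (le_top : posEigen ρ π i * posEigen ρ π j ≤ ⊤))
  · exact le_of_eq_of_le (by ring) (mul_le_mul' (h0 i j h) (le_top : posEigen ρ π k ≤ ⊤))
  · exact le_of_eq_of_le (by ring) (mul_le_mul' (h0 i k h) (le_top : posEigen ρ π j ≤ ⊤))
  · exact le_of_eq_of_le (by ring) (mul_le_mul' (h0 j k h) (le_top : posEigen ρ π i ≤ ⊤))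
  · calc _ = posEigen ρ π i * posEigen ρ π j * posEigen ρ π k * 1 := by ring
      _ ≤ posInvariants ρ * ⊤ := mul_le_mul' ((mul_le_mul' (posEigen_mul_le ρ π i j) le_rfl).trans
        (h0 _ _ h)) le_top

lemma iSup_posEigen_pow_even_le (k : ℕ) :
    (⨆ c, posEigen ρ π c) ^ (2 * k + 2) ≤
      posInvariants ρ ^ k * (⨆ c, posEigen ρ π c) ^ 2 := by
  induction k with
  | zero => simp
  | succ k ih =>
    calc (⨆ c, posEigen ρ π c) ^ (2 * (k + 1) + 2)
        = (⨆ c, posEigen ρ π c) ^ (2 * k) * (⨆ c, posEigen ρ π c) ^ 4 := by ring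
      _ ≤ (⨆ c, posEigen ρ π c) ^ (2 * k) *
            (posInvariants ρ * (⨆ c, posEigen ρ π c) ^ 2) :=
          mul_le_mul' le_rfl (iSup_posEigen_pow_four_le ρ π)
      _ = posInvariants ρ * (⨆ c, posEigen ρ π c) ^ (2 * k + 2) := by ring
      _ ≤ posInvariants ρ * (posInvariants ρ ^ k * (⨆ c, posEigen ρ π c) ^ 2) :=
          mul_le_mul' le_rfl ih
      _ = posInvariants ρ ^ (k + 1) * (⨆ c, posEigen ρ π c) ^ 2 := by ring

variable [CharZero F] [Fintype G]

/-- `F[V] (F[V]^N_+)^(2k+1) ⊆ F[V] (F[V]^G_+)^k` for `G / N` embedded in the Klein four-group. -/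
lemma posInvariants_ker_pow_le (k : ℕ) :
    posInvariants (ρ.comp π.ker.subtype) ^ (2 * k + 1) ≤ posInvariants ρ ^ k * ⊤ := by
  refine (pow_le_pow_left' (posInvariants_ker_le ρ π) _).trans ?_
  cases k with
  | zero => simp
  | succ k =>
    calc (⨆ c, posEigen ρ π c) ^ (2 * (k + 1) + 1)
        = (⨆ c, posEigen ρ π c) ^ (2 * k + 2) * (⨆ c, posEigen ρ π c) := by ring
      _ ≤ posInvariants ρ ^ k * (⨆ c, posEigen ρ π c) ^ 2 * (⨆ c, posEigen ρ π c) :=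
          mul_le_mul' (iSup_posEigen_pow_even_le ρ π k) le_rfl
      _ = posInvariants ρ ^ k * (⨆ c, posEigen ρ π c) ^ 3 := by ring
      _ ≤ posInvariants ρ ^ k * (posInvariants ρ * ⊤) :=
          mul_le_mul' le_rfl (iSup_posEigen_pow_three_le ρ π)
      _ = posInvariants ρ ^ (k + 1) * ⊤ := by ring

/-- `F[V]^G ∩ (F[V]^N_+)^(2k+2) ⊆ (F[V]^G_+)^(k+1)` for `G / N` embedded in the Klein
four-group. -/
lemma mem_posInvariants_pow_of_ker {k : ℕ} {f : MvPolynomial (Fin n) F}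
    (hf : f ∈ invariantRing ρ)
    (hfN : f ∈ posInvariants (ρ.comp π.ker.subtype) ^ (2 * k + 2)) :
    f ∈ posInvariants ρ ^ (k + 1) := by
  refine mem_posInvariants_pow_succ ρ hf (((pow_le_pow_left' (posInvariants_ker_le ρ π) _).trans
    ((iSup_posEigen_pow_even_le ρ π k).trans (mul_le_mul' le_rfl ?_))) hfN)
  rw [pow_two]
  exact (iSup_posEigen_mul_self_le ρ π).trans (iSup_posEigen_le_posDegree ρ π)

end KleinEigenspaces

section EmbeddedInKlein

variable {F : Type*} [Field F] {G : Type*} [Group G] {n : ℕ} (ρ : G →* GL (Fin n) F)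
  {π : G →* Cyc 2 × Cyc 2}

/-- For the trivial group all forms of degree `d ≥ m > 0` lie in the `m`th power. -/
lemma mem_posInvariants_ker_pow (hπ : Function.Injective π) {m d : ℕ} (hm : m ≠ 0) (hmd : m ≤ d)
    {f : MvPolynomial (Fin n) F} (hf : f.IsHomogeneous d) :
    f ∈ posInvariants (ρ.comp π.ker.subtype) ^ m := by
  set P := posInvariants (ρ.comp π.ker.subtype) with hP
  have hall : ∀ p, p ∈ invariantRing (ρ.comp π.ker.subtype) := by
    rintro p ⟨g, hg⟩
    obtain rfl : g = 1 := hπ (by rw [hg, map_one])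
    exact polyAct_one _ p
  have hone : homogeneousSubmodule (Fin n) F 1 ≤ P := fun p hp =>
    mem_posInvariants _ (hall p) one_pos hp
  have hPP : P * P ≤ P := by
    rw [hP, posInvariants, Submodule.span_mul_span]
    refine Submodule.span_mono ?_
    rintro _ ⟨p, ⟨-, a, ha, hpa⟩, q, ⟨-, b, hb, hqb⟩, rfl⟩
    exact ⟨hall _, a + b, by omega, hpa.mul hqb⟩
  have hpow : ∀ j, P ^ (m + j) ≤ P ^ m := fun j => by
    induction j with
    | zero => rfl
    | succ j ih =>
      obtain ⟨l, rfl⟩ := Nat.exists_eq_succ_of_ne_zero hm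
      calc P ^ (l.succ + (j + 1)) = P ^ (l + j) * (P * P) := by rw [Nat.succ_eq_add_one]; ring
        _ ≤ P ^ (l + j) * P := mul_le_mul' le_rfl hPP
        _ = P ^ (l.succ + j) := by rw [Nat.succ_eq_add_one]; ring
        _ ≤ _ := ih
  obtain ⟨j, rfl⟩ := Nat.exists_eq_add_of_le hmd
  refine hpow j (pow_le_pow_left' hone _ ?_)
  rw [homogeneousSubmodule_one_pow]
  exact hf

variable [CharZero F] [Fintype G]

lemma mem_posInvariants_pow_mul_top (hπ : Function.Injective π) {k d : ℕ} (hd : 2 * k + 1 ≤ d)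
    {f : MvPolynomial (Fin n) F} (hf : f.IsHomogeneous d) : f ∈ posInvariants ρ ^ k * ⊤ :=
  posInvariants_ker_pow_le ρ π k (mem_posInvariants_ker_pow ρ hπ (by omega) hd hf)

lemma mem_posInvariants_pow (hπ : Function.Injective π) {k d : ℕ} (hd : 2 * k + 2 ≤ d)
    {f : MvPolynomial (Fin n) F} (hf : f ∈ invariantRing ρ) (hfd : f.IsHomogeneous d) :
    f ∈ posInvariants ρ ^ (k + 1) :=
  mem_posInvariants_pow_of_ker ρ π hf (mem_posInvariants_ker_pow ρ hπ (by omega) hd hfd)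

lemma noetherNumberOf_le_of_injective (hπ : Function.Injective π) (k : ℕ) :
    noetherNumberOf k ρ ≤ (2 * k + 1 : ℕ) := by
  refine iSup₂_le fun d ⟨f, hf, hfd, hfk⟩ => ?_
  by_contra h
  rw [Nat.cast_le, not_le] at h
  exact hfk (mem_posInvariants_pow ρ hπ h (posInvariants_le_invariantRing ρ hf) hfd)

end EmbeddedInKlein

section KleinExtension

variable {F : Type*} [Field F] [CharZero F] {G : Type*} [Group G] [Fintype G] {n : ℕ}
  (ρ : G →* GL (Fin n) F) {π : G →* Cyc 2 × Cyc 2} {ψ : π.ker →* Cyc 2 × Cyc 2}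

lemma noetherNumberOf_le_of_extension (hψ : Function.Injective ψ) : noetherNumberOf 1 ρ ≤ 7 := by
  classical
  refine iSup₂_le fun d ⟨f, hf, hfd, hfk⟩ => ?_
  by_contra h
  have h8 : 8 ≤ d := by
    rw [not_le] at h
    exact_mod_cast h
  have hinv := posInvariants_le_invariantRing ρ hf
  exact hfk (mem_posInvariants_pow_of_ker ρ π (k := 1) hinv
    (mem_posInvariants_pow (ρ.comp π.ker.subtype) hψ (k := 3) h8 (fun g => hinv g) hfd))

lemma coinvariantDegreeOf_le_of_extension (hψ : Function.Injective ψ) :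
    coinvariantDegreeOf 1 ρ ≤ 6 := by
  classical
  refine iSup₂_le fun d ⟨f, hfd, hfk⟩ => ?_
  by_contra h
  have h7 : 7 ≤ d := by
    rw [not_le] at h
    exact_mod_cast h
  have h1 := mem_posInvariants_pow_mul_top (ρ.comp π.ker.subtype) hψ (k := 3) h7 hfd
  have h2 := mul_le_mul' (posInvariants_ker_pow_le ρ π 1)
    (le_refl (⊤ : Submodule F (MvPolynomial (Fin n) F))) h1
  refine hfk ?_
  suffices H : posInvariants ρ ^ 1 * ⊤ * ⊤ ≤ (Ideal.span
      ((posInvariants ρ ^ 1 : Submodule F (MvPolynomial (Fin n) F)) :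
        Set (MvPolynomial (Fin n) F))).restrictScalars F from H h2
  rw [mul_assoc]
  exact Submodule.mul_le.2 fun a ha b _ => Ideal.mul_mem_right _ _ (Ideal.subset_span ha)

end KleinExtension

section KleinNoether

/-- The sum of the three nontrivial characters of the Klein four-group. -/
noncomputable def kleinRep : Cyc 2 × Cyc 2 →* GL (Fin 3) ℂ :=
  MonoidHom.toHomUnits
    { toFun := fun k => Matrix.diagonal ![(kleinChar (1, 0) k : ℂ), kleinChar (0, 1) k,
        kleinChar (1, 1) k]
      map_one' := by
        ext i j
        fin_cases i <;> fin_cases j <;> simp [kleinChar_one]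
      map_mul' := fun k l => by
        rw [Matrix.diagonal_mul_diagonal]
        congr 1
        ext i
        fin_cases i <;> simp [kleinChar_mul] }

lemma polyAct_kleinRep_X (k : Cyc 2 × Cyc 2) (j : Fin 3) :
    polyAct kleinRep k (X j) =
      (![kleinChar (1, 0) k, kleinChar (0, 1) k, kleinChar (1, 1) k] j : ℂ) • X j := by
  have hinv : k⁻¹ = k := by revert k; decide
  rw [polyAct_X, hinv, MvPolynomial.smul_eq_C_mul]
  have : ((kleinRep k : GL (Fin 3) ℂ) : Matrix (Fin 3) (Fin 3) ℂ) =
    Matrix.diagonal ![(kleinChar (1, 0) k : ℂ), kleinChar (0, 1) k, kleinChar (1, 1) k] := rfl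
  rw [this]
  fin_cases j <;> simp [Fin.sum_univ_three, Matrix.diagonal]

end KleinNoether

section Orders

variable {F : Type*} [Field F] {G : Type*} [Group G] {n : ℕ}

/-- If there are no invariant linear forms, then `(F[V]^G_+)^k` starts in degree `2k`. -/
lemma coeff_eq_zero_of_mem_posInvariants_pow {ρ : G →* GL (Fin n) F}
    (h1 : ∀ f ∈ invariantRing ρ, f.IsHomogeneous 1 → f = 0) {k : ℕ} {f : MvPolynomial (Fin n) F}
    (hf : f ∈ posInvariants ρ ^ k) {m : Fin n →₀ ℕ} (hm : m.degree < 2 * k) : f.coeff m = 0 := by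
  induction k generalizing f m with
  | zero => omega
  | succ k ih =>
    rw [pow_succ] at hf
    induction hf using Submodule.mul_induction_on' with
    | add a _ b _ ha hb => rw [coeff_add, ha, hb, add_zero]
    | mem_mul_mem a ha b hb =>
      have hb2 : ∀ m : Fin n →₀ ℕ, m.degree < 2 → b.coeff m = 0 := by
        intro m hm
        induction hb using Submodule.span_induction with
        | zero => simp
        | add p q _ _ hp hq => rw [coeff_add, hp, hq, add_zero]
        | smul c p _ hp => rw [coeff_smul, hp, smul_zero]
        | mem p hp =>
          obtain ⟨hp, d, hd, hpd⟩ := hp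
          by_cases hd1 : d = 1
          · rw [h1 p hp (hd1 ▸ hpd), coeff_zero]
          · exact hpd.coeff_eq_zero (by omega)
      rw [coeff_mul]
      refine Finset.sum_eq_zero fun x hx => ?_
      rw [Finset.HasAntidiagonal.mem_antidiagonal] at hx
      have hdeg : x.1.degree + x.2.degree = m.degree := by rw [← hx, map_add]
      by_cases h : x.1.degree < 2 * k
      · rw [ih ha h, zero_mul]
      · rw [hb2 _ (by omega), mul_zero]

end Orders

section KleinNoether

lemma kleinRep_linear_invariant {f : MvPolynomial (Fin 3) ℂ} (hf : f ∈ invariantRing kleinRep)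
    (hf1 : f.IsHomogeneous 1) : f = 0 := by
  have hmem : f ∈ homogeneousSubmodule (Fin 3) ℂ 1 := hf1
  rw [homogeneousSubmodule_one_eq_span_X, Submodule.mem_span_range_iff_exists_fun] at hmem
  obtain ⟨c, rfl⟩ := hmem
  have ha := hf (Multiplicative.ofAdd 1, 1)
  have hb := hf (1, Multiplicative.ofAdd 1)
  simp only [map_add, map_smul, polyAct_kleinRep_X, Fin.sum_univ_three] at ha hb ⊢
  have hX : ∀ i j : Fin 3, (X i : MvPolynomial (Fin 3) ℂ).coeff (Finsupp.single j 1) =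
      if i = j then 1 else 0 := fun i j => by
    simp [coeff_X, Finsupp.single_left_inj]
  have e1 : kleinChar (1, 0) (Multiplicative.ofAdd 1, 1) = -1 := by decide
  have e2 : kleinChar (0, 1) (1, Multiplicative.ofAdd 1) = -1 := by decide
  have e3 : kleinChar (1, 1) (1, Multiplicative.ofAdd 1) = -1 := by decide
  have h0 := congrArg (coeff (Finsupp.single 0 1)) ha
  have h1 := congrArg (coeff (Finsupp.single 1 1)) hb
  have h2 := congrArg (coeff (Finsupp.single 2 1)) hb
  simp [hX, e1, e2, e3] at h0 h1 h2
  have z : ∀ z : ℂ, -z = z → z = 0 := fun z hz => by linear_combination -hz / 2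
  rw [z _ h0, z _ h1, z _ h2]
  simp

/-- The `k`th Noether number of the Klein four-group. -/
theorem noetherNumber_klein {k : ℕ} (hk : 0 < k) :
    noetherNumber ℂ k (Cyc 2 × Cyc 2) = (2 * k + 1 : ℕ) := by
  refine le_antisymm (iSup₂_le fun n ρ =>
    noetherNumberOf_le_of_injective ρ (π := MonoidHom.id _) Function.injective_id k) ?_
  refine le_trans ?_ (le_iSup₂_of_le 3 kleinRep le_rfl)
  obtain ⟨j, rfl⟩ : ∃ j, k = j + 1 := ⟨k - 1, by omega⟩
  let f : MvPolynomial (Fin 3) ℂ := X 0 ^ (2 * j + 1) * X 1 * X 2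
  have hfd : f.IsHomogeneous (2 * (j + 1) + 1) := by
    have := ((isHomogeneous_X_pow (R := ℂ) (0 : Fin 3) (2 * j + 1)).mul
      (isHomogeneous_X ℂ (1 : Fin 3))).mul (isHomogeneous_X ℂ (2 : Fin 3))
    convert this using 1
    omega
  have hfinv : f ∈ invariantRing kleinRep := by
    intro g
    simp only [f, map_mul, map_pow, polyAct_kleinRep_X]
    have hs : kleinChar (1, 0) g ^ 2 = 1 := by revert g; decide
    have hp : kleinChar (1, 0) g * kleinChar (0, 1) g * kleinChar (1, 1) g = 1 := by
      revert g; decide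
    have key : ((kleinChar (1, 0) g : ℂ) ^ (2 * j + 1)) * kleinChar (0, 1) g * kleinChar (1, 1) g
        = 1 := by
      rw [pow_succ, pow_mul]
      norm_cast
      rw [hs, one_pow, one_mul, hp]
    simp only [Matrix.cons_val_zero, Matrix.cons_val_one, Matrix.cons_val, smul_pow,
      smul_mul_smul_comm, key, one_smul]
  refine le_iSup₂_of_le (2 * (j + 1) + 1)
    ⟨f, mem_posInvariants _ hfinv (by omega) hfd, hfd, fun hmem => ?_⟩ le_rfl
  have hf0 : f ≠ 0 := by simp [f, X_ne_zero]
  obtain ⟨m, hm⟩ := ne_zero_iff.1 hf0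
  refine hm (coeff_eq_zero_of_mem_posInvariants_pow (fun _ => kleinRep_linear_invariant) hmem ?_)
  have : m.degree = 2 * (j + 1) + 1 := by
    by_contra h
    exact hm (hfd.coeff_eq_zero h)
  omega

end KleinNoether

section Davenport

variable {G : Type*} [Group G]

lemma mem_productOneMonoid_iff {A : Type*} [CommGroup A] {S : Multiset A} :
    S ∈ productOneMonoid A ↔ S.prod = 1 := by
  constructor
  · rintro ⟨l, rfl, hl⟩
    simpa using hl
  · intro h
    obtain ⟨l, rfl⟩ := Quot.exists_rep S
    exact ⟨l, rfl, by simpa using h⟩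

lemma isAddUnit_productOneMonoid_iff {a : productOneMonoid G} : IsAddUnit a ↔ a = 0 := by
  refine ⟨fun h => ?_, fun h => h ▸ isAddUnit_zero⟩
  obtain ⟨b, hb⟩ := h.exists_neg
  have := congrArg (fun x : productOneMonoid G => Multiset.card (x : Multiset G)) hb
  simp only [AddSubmonoid.coe_add, Multiset.card_add, ZeroMemClass.coe_zero,
    Multiset.card_zero] at this
  exact Subtype.ext (Multiset.card_eq_zero.1 (by omega))

lemma card_pos_of_ne_zero {a : productOneMonoid G} (ha : a ≠ 0) :
    0 < Multiset.card (a : Multiset G) :=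
  Multiset.card_pos.2 fun h => ha (Subtype.ext h)

lemma add_mem_lengthSet {a b : productOneMonoid G} {m l : ℕ} (hm : m ∈ lengthSet a)
    (hl : l ∈ lengthSet b) : m + l ∈ lengthSet (a + b) := by
  obtain ⟨s, rfl, hs, rfl⟩ := hm
  obtain ⟨t, rfl, ht, rfl⟩ := hl
  refine ⟨s + t, Multiset.card_add _ _, fun u hu => ?_, Multiset.sum_add _ _⟩
  rcases Multiset.mem_add.1 hu with h | h
  exacts [hs u h, ht u h]

/-- Every nontrivial product-one sequence is a product of at least one atom. -/
lemma exists_pos_mem_lengthSet {a : productOneMonoid G} (ha : a ≠ 0) :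
    ∃ m ∈ lengthSet a, 0 < m := by
  induction hc : Multiset.card (a : Multiset G) using Nat.strong_induction_on generalizing a with
  | _ c ih =>
    by_cases hirr : AddIrreducible a
    · exact ⟨1, ⟨{a}, rfl, by simpa using hirr, by simp⟩, one_pos⟩
    · rw [addIrreducible_iff, isAddUnit_productOneMonoid_iff] at hirr
      simp only [isAddUnit_productOneMonoid_iff] at hirr
      push Not at hirr
      obtain ⟨b, d, rfl, hb, hd⟩ := hirr ha
      have hcard : Multiset.card (b : Multiset G) + Multiset.card (d : Multiset G) = c := by
        rw [← hc, AddSubmonoid.coe_add, Multiset.card_add]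
      have hb' := card_pos_of_ne_zero hb
      have hd' := card_pos_of_ne_zero hd
      obtain ⟨m, hm, hm0⟩ := ih _ (by omega) hb rfl
      obtain ⟨l, hl, -⟩ := ih _ (by omega) hd rfl
      exact ⟨m + l, add_mem_lengthSet hm hl, by omega⟩

/-- A sequence of at least four elements of the Klein four-group contains a nonempty product-one
sequence of length at most two. -/
lemma exists_short_productOne {S : Multiset (Cyc 2 × Cyc 2)} (hS : 4 ≤ Multiset.card S) :
    ∃ T ≤ S, T ≠ 0 ∧ Multiset.card T ≤ 2 ∧ T.prod = 1 := by
  by_cases h1 : (1 : Cyc 2 × Cyc 2) ∈ S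
  · exact ⟨{1}, by simpa using h1, by simp, by simp, by simp⟩
  by_cases hnd : S.Nodup
  · exfalso
    have hcard := Finset.card_le_card (Finset.subset_erase.2
      ⟨Finset.subset_univ (⟨S, hnd⟩ : Finset (Cyc 2 × Cyc 2)), h1⟩)
    have : (Finset.univ.erase (1 : Cyc 2 × Cyc 2)).card = 3 := by decide
    rw [this, Finset.card_mk] at hcard
    omega
  · rw [Multiset.nodup_iff_le] at hnd
    push Not at hnd
    obtain ⟨g, hg⟩ := hnd
    refine ⟨_, hg, by simp, by simp, ?_⟩
    have hsq : ∀ x : Cyc 2 × Cyc 2, x * (x * 1) = 1 := by decide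
    simpa using hsq g

lemma exists_lt_mem_lengthSet {k : ℕ} {a : productOneMonoid (Cyc 2 × Cyc 2)}
    (ha : 2 * k + 2 ≤ Multiset.card (a : Multiset (Cyc 2 × Cyc 2))) :
    ∃ m ∈ lengthSet a, k < m := by
  induction k generalizing a with
  | zero =>
    refine exists_pos_mem_lengthSet fun h => ?_
    rw [h] at ha
    simp at ha
  | succ k ih =>
    obtain ⟨T, hTa, hT0, hT2, hT1⟩ := exists_short_productOne (S := a) (by omega)
    obtain ⟨U, hU⟩ := Multiset.le_iff_exists_add.1 hTa
    have haprod : (a : Multiset (Cyc 2 × Cyc 2)).prod = 1 := mem_productOneMonoid_iff.1 a.2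
    have hU1 : U.prod = 1 := by
      rw [hU, Multiset.prod_add, hT1, one_mul] at haprod
      exact haprod
    have hcard : Multiset.card T + Multiset.card U =
        Multiset.card (a : Multiset (Cyc 2 × Cyc 2)) := by rw [hU, Multiset.card_add]
    let t : productOneMonoid (Cyc 2 × Cyc 2) := ⟨T, mem_productOneMonoid_iff.2 hT1⟩
    let u : productOneMonoid (Cyc 2 × Cyc 2) := ⟨U, mem_productOneMonoid_iff.2 hU1⟩
    obtain ⟨m, hm, hm0⟩ := exists_pos_mem_lengthSet (a := t) fun h => hT0 (congrArg Subtype.val h)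
    obtain ⟨l, hl, hlk⟩ := ih (a := u) (by simp only [u]; omega)
    have hau : a = t + u := Subtype.ext hU
    exact ⟨m + l, hau ▸ add_mem_lengthSet hm hl, by omega⟩

/-- Without trivial terms, a product of `m` atoms has length at least `2m`. -/
lemma two_mul_le_card_of_mem_lengthSet {a : productOneMonoid G}
    (h1 : (1 : G) ∉ (a : Multiset G)) {m : ℕ} (hm : m ∈ lengthSet a) :
    2 * m ≤ Multiset.card (a : Multiset G) := by
  obtain ⟨s, rfl, hs, rfl⟩ := hm
  induction s using Multiset.induction_on with
  | empty => simp
  | cons u s ih =>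
    rw [Multiset.sum_cons, AddSubmonoid.coe_add] at h1 ⊢
    rw [Multiset.mem_add, not_or] at h1
    rw [Multiset.card_add, Multiset.card_cons]
    have hs' := ih (fun v hv => hs v (Multiset.mem_cons_of_mem hv)) h1.2
    have hu := card_pos_of_ne_zero fun h : u = 0 =>
      (hs u (Multiset.mem_cons_self u s)).not_isAddUnit (isAddUnit_productOneMonoid_iff.2 h)
    have hu1 : Multiset.card (u : Multiset G) ≠ 1 := fun h => by
      obtain ⟨l, hl, hl1⟩ := u.2
      obtain ⟨g, hg⟩ := Multiset.card_eq_one.1 h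
      rw [hg, Multiset.coe_eq_singleton] at hl
      rw [hl, List.prod_singleton] at hl1
      exact h1.1 (by rw [hg, hl1]; exact Multiset.mem_singleton_self _)
    omega

/-- The `k`th Davenport constant of the Klein four-group. -/
theorem davenport_klein {k : ℕ} (hk : 0 < k) : davenport k (Cyc 2 × Cyc 2) = (2 * k + 1 : ℕ) := by
  refine le_antisymm (iSup₂_le fun a ha => ?_) ?_
  · by_contra h
    rw [Nat.cast_le, not_le] at h
    obtain ⟨m, hm, hkm⟩ := exists_lt_mem_lengthSet (k := k) h
    exact absurd (ha m hm) (by omega)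
  · obtain ⟨j, rfl⟩ : ∃ j, k = j + 1 := ⟨k - 1, by omega⟩
    let e : Cyc 2 × Cyc 2 := (Multiplicative.ofAdd 1, 1)
    let T : Multiset (Cyc 2 × Cyc 2) :=
      {e, (1, Multiplicative.ofAdd 1), (Multiplicative.ofAdd 1, Multiplicative.ofAdd 1)}
    have hT1 : T.prod = 1 := by decide
    have he : e ^ 2 = 1 := by decide
    have h1T : (1 : Cyc 2 × Cyc 2) ∉ T := by decide
    have h1e : (1 : Cyc 2 × Cyc 2) ≠ e := by decide
    let a : productOneMonoid (Cyc 2 × Cyc 2) := ⟨Multiset.replicate (2 * j) e + T,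
      mem_productOneMonoid_iff.2 (by
        rw [Multiset.prod_add, hT1, Multiset.prod_replicate, pow_mul, he, one_pow, one_mul])⟩
    have hcard : Multiset.card (a : Multiset (Cyc 2 × Cyc 2)) = 2 * (j + 1) + 1 := by
      simp only [a, Multiset.card_add, Multiset.card_replicate]
      rfl
    have h1 : (1 : Cyc 2 × Cyc 2) ∉ (a : Multiset (Cyc 2 × Cyc 2)) := by
      simp only [a, Multiset.mem_add, not_or]
      exact ⟨fun h => h1e (Multiset.eq_of_mem_replicate h), h1T⟩
    refine le_iSup₂_of_le a (fun m hm => ?_) (by rw [hcard])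
    have := two_mul_le_card_of_mem_lengthSet h1 hm
    omega

end Davenport

section Presentation

/-- The homomorphism from `C_n` that sends the generator to an element `g` with `g ^ n = 1`. -/
def cycHom {H : Type*} [Group H] {n : ℕ} [NeZero n] (g : H) (hg : g ^ n = 1) : Cyc n →* H where
  toFun k := g ^ k.toAdd.val
  map_one' := by simp
  map_mul' k l := by
    rw [toAdd_mul, ZMod.val_add, ← pow_add]
    exact (pow_eq_pow_mod _ hg).symm

/-- The action of `C_2` on `C_4 × C_2` by `(a, c) ↦ (a + 2c, c)`. -/
def pauliTwist : Cyc 2 →* MulAut (Cyc 4 × Cyc 2) where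
  toFun b :=
    { toFun := fun x => (x.1 * Multiplicative.ofAdd
        ((2 * b.toAdd.val * x.2.toAdd.val : ℕ) : ZMod 4), x.2)
      invFun := fun x => (x.1 * Multiplicative.ofAdd
        ((2 * b.toAdd.val * x.2.toAdd.val : ℕ) : ZMod 4), x.2)
      left_inv := by unfold Function.LeftInverse; revert b; decide
      right_inv := by unfold Function.RightInverse Function.LeftInverse; revert b; decide
      map_mul' := by revert b; decide }
  map_one' := by ext1 x; revert x; decide
  map_mul' b b' := by ext1 x; revert b b' x; decide

variable {H : Type*} [Group H] {u z x : H}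

/-- The homomorphism to a group with elements satisfying the relations of the scalar `i` and of
the Pauli matrices `σ₃` and `σ₁`. -/
def pauliLift (hu : u ^ 4 = 1) (hz : z ^ 2 = 1) (hx : x ^ 2 = 1) (huz : Commute u z)
    (hux : Commute u x) (hxz : x * z = u ^ 2 * z * x) :
    (Cyc 4 × Cyc 2) ⋊[pauliTwist] Cyc 2 →* H :=
  SemidirectProduct.lift
    ((cycHom u hu).noncommCoprod (cycHom z hz) fun a c => huz.pow_pow _ _) (cycHom x hx) (by
    intro b
    ext1 ⟨a, c⟩
    have key : ∀ (b c : Cyc 2) (a : Cyc 4), cycHom u hu (pauliTwist b (a, c)).1 * cycHom z hz c *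
        cycHom x hx b = cycHom x hx b * (cycHom u hu a * cycHom z hz c) := by
      intro b c a
      have h1 : cycHom u hu a * cycHom x hx b = cycHom x hx b * cycHom u hu a :=
        hux.pow_pow _ _
      have h2 : (pauliTwist b (a, c)).1 = a * Multiplicative.ofAdd
        ((2 * b.toAdd.val * c.toAdd.val : ℕ) : ZMod 4) := rfl
      have h3 : cycHom x hx b * cycHom z hz c = cycHom u hu (Multiplicative.ofAdd
          ((2 * b.toAdd.val * c.toAdd.val : ℕ) : ZMod 4)) * cycHom z hz c * cycHom x hx b := by
        have hb : ∀ b : Cyc 2, b = 1 ∨ b = Multiplicative.ofAdd 1 := by decide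
        have hval : (1 : ZMod 2).val = 1 := rfl
        rcases hb b with rfl | rfl
        · simp
        rcases hb c with rfl | rfl
        · simp
        · have h22 : ((2 : ℕ) : ZMod 4).val = 2 := rfl
          simp only [cycHom, MonoidHom.coe_mk, OneHom.coe_mk, toAdd_ofAdd, hval, mul_one, h22,
            pow_one]
          exact hxz
      rw [h2, map_mul, ← mul_assoc, ← h1, mul_assoc _ (cycHom x hx b), h3]
      simp only [mul_assoc]
    simp only [MonoidHom.comp_apply, MulEquiv.coe_toMonoidHom, MulAut.conj_apply]
    rw [eq_mul_inv_iff_mul_eq]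
    exact key b c a)

lemma pauliLift_apply (hu : u ^ 4 = 1) (hz : z ^ 2 = 1) (hx : x ^ 2 = 1) (huz : Commute u z)
    (hux : Commute u x) (hxz : x * z = u ^ 2 * z * x)
    (p : (Cyc 4 × Cyc 2) ⋊[pauliTwist] Cyc 2) :
    pauliLift hu hz hx huz hux hxz p = u ^ p.left.1.toAdd.val * z ^ p.left.2.toAdd.val *
      x ^ p.right.toAdd.val := rfl

end Presentation

section PauliStructure

/-- The scalar matrix `i`. -/
noncomputable def pauliI : GL (Fin 2) ℂ :=
  Matrix.GeneralLinearGroup.mkOfDetNeZero !![Complex.I, 0; 0, Complex.I]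
    (by simp [Matrix.det_fin_two])

lemma coe_pauliX : (pauliX : Matrix (Fin 2) (Fin 2) ℂ) = !![0, 1; 1, 0] := rfl

lemma coe_pauliY : (pauliY : Matrix (Fin 2) (Fin 2) ℂ) = !![0, -Complex.I; Complex.I, 0] := rfl

lemma coe_pauliZ : (pauliZ : Matrix (Fin 2) (Fin 2) ℂ) = !![1, 0; 0, -1] := rfl

lemma coe_pauliI : (pauliI : Matrix (Fin 2) (Fin 2) ℂ) = !![Complex.I, 0; 0, Complex.I] := rfl

lemma pauliI_sq : pauliI ^ 2 = -1 := by
  ext i j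
  fin_cases i <;> fin_cases j <;> simp [pow_two, coe_pauliI]

lemma pauliI_pow_four : pauliI ^ 4 = 1 := by
  rw [show 4 = 2 * 2 from rfl, pow_mul, pauliI_sq]
  simp

lemma pauliX_sq : pauliX ^ 2 = 1 := by
  ext i j
  fin_cases i <;> fin_cases j <;> simp [pow_two, coe_pauliX]

lemma pauliY_sq : pauliY ^ 2 = 1 := by
  ext i j
  fin_cases i <;> fin_cases j <;> simp [pow_two, coe_pauliY]

lemma pauliZ_sq : pauliZ ^ 2 = 1 := by
  ext i j
  fin_cases i <;> fin_cases j <;> simp [pow_two, coe_pauliZ]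

lemma commute_pauliI_pauliZ : Commute pauliI pauliZ := by
  ext i j
  fin_cases i <;> fin_cases j <;> simp [coe_pauliI, coe_pauliZ]

lemma commute_pauliI_pauliX : Commute pauliI pauliX := by
  ext i j
  fin_cases i <;> fin_cases j <;> simp [coe_pauliI, coe_pauliX]

lemma pauliX_mul_pauliZ : pauliX * pauliZ = pauliI ^ 2 * pauliZ * pauliX := by
  rw [pauliI_sq]
  ext i j
  fin_cases i <;> fin_cases j <;> simp [coe_pauliX, coe_pauliZ]

lemma pauliX_mul_pauliY_mul_pauliZ : pauliX * pauliY * pauliZ = pauliI := by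
  ext i j
  fin_cases i <;> fin_cases j <;> simp [coe_pauliX, coe_pauliY, coe_pauliZ, coe_pauliI]

lemma pauliY_eq : pauliY = pauliI * pauliX * pauliZ := by
  ext i j
  fin_cases i <;> fin_cases j <;> simp [coe_pauliX, coe_pauliY, coe_pauliZ, coe_pauliI]

lemma pauliX_mem : pauliX ∈ pauliGroup := Subgroup.subset_closure (by simp)

lemma pauliY_mem : pauliY ∈ pauliGroup := Subgroup.subset_closure (by simp)

lemma pauliZ_mem : pauliZ ∈ pauliGroup := Subgroup.subset_closure (by simp)

lemma pauliI_mem : pauliI ∈ pauliGroup := by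
  rw [← pauliX_mul_pauliY_mul_pauliZ]
  exact mul_mem (mul_mem pauliX_mem pauliY_mem) pauliZ_mem

/-- The parametrization of the Pauli group by `(C_4 × C_2) ⋊ C_2`. -/
noncomputable def pauliParam : (Cyc 4 × Cyc 2) ⋊[pauliTwist] Cyc 2 →* GL (Fin 2) ℂ :=
  pauliLift pauliI_pow_four pauliZ_sq pauliX_sq commute_pauliI_pauliZ commute_pauliI_pauliX
    pauliX_mul_pauliZ

lemma pauliParam_injective : Function.Injective pauliParam := by
  rw [injective_iff_map_eq_one]
  rintro ⟨⟨a, c⟩, b⟩ h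
  have hb : ∀ b : Cyc 2, b = 1 ∨ b = Multiplicative.ofAdd 1 := by decide
  have ha : ∀ a : Cyc 4, a = 1 ∨ a = Multiplicative.ofAdd 1 ∨ a = Multiplicative.ofAdd 2 ∨
    a = Multiplicative.ofAdd 3 := by decide
  have v1 : (1 : ZMod 2).val = 1 := rfl
  have v1' : (1 : ZMod 4).val = 1 := rfl
  have v2 : (2 : ZMod 4).val = 2 := rfl
  have v3 : (3 : ZMod 4).val = 3 := rfl
  rw [pauliParam, pauliLift_apply] at h
  have h0 := congrArg (fun g : GL (Fin 2) ℂ => (g : Matrix (Fin 2) (Fin 2) ℂ) 0 0) h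
  have h1 := congrArg (fun g : GL (Fin 2) ℂ => (g : Matrix (Fin 2) (Fin 2) ℂ) 1 1) h
  have hI : Complex.I ≠ 1 := fun h => by simpa using congrArg Complex.re h
  have hI' : -Complex.I ≠ 1 := fun h => by simpa using congrArg Complex.re h
  have hn : (-1 : ℂ) ≠ 1 := by norm_num
  have hp3 : pauliI ^ 3 = pauliI ^ 2 * pauliI := pow_succ _ _
  rcases hb b with rfl | rfl <;> rcases hb c with rfl | rfl <;>
    rcases ha a with rfl | rfl | rfl | rfl <;>
    simp [v1, v1', v2, v3, hp3, pauliI_sq, coe_pauliI, coe_pauliX, coe_pauliZ, hI, hI', hn]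
      at h0 h1 ⊢
  rfl

lemma range_pauliParam : pauliParam.range = pauliGroup := by
  refine le_antisymm ?_ ((Subgroup.closure_le _).2 ?_)
  · rintro _ ⟨p, rfl⟩
    exact mul_mem (mul_mem (pow_mem pauliI_mem _) (pow_mem pauliZ_mem _)) (pow_mem pauliX_mem _)
  · have hX : pauliX ∈ pauliParam.range := ⟨⟨(1, 1), Multiplicative.ofAdd 1⟩, by
      rw [pauliParam, pauliLift_apply]
      have : (1 : ZMod 2).val = 1 := rfl
      simp [this]⟩
    have hZ : pauliZ ∈ pauliParam.range := ⟨⟨(1, Multiplicative.ofAdd 1), 1⟩, by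
      rw [pauliParam, pauliLift_apply]
      have : (1 : ZMod 2).val = 1 := rfl
      simp [this]⟩
    have hI : pauliI ∈ pauliParam.range := ⟨⟨(Multiplicative.ofAdd 1, 1), 1⟩, by
      rw [pauliParam, pauliLift_apply]
      have : (1 : ZMod 4).val = 1 := rfl
      simp [this]⟩
    rintro _ (rfl | rfl | rfl)
    · exact hX
    · rw [pauliY_eq]
      exact mul_mem (mul_mem hI hX) hZ
    · exact hZ

/-- The Pauli group is a semidirect product of `C_4 × C_2` and `C_2`. -/
noncomputable def pauliEquiv : pauliGroup ≃* (Cyc 4 × Cyc 2) ⋊[pauliTwist] Cyc 2 :=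
  ((MonoidHom.ofInjective pauliParam_injective).trans
    (MulEquiv.subgroupCongr range_pauliParam)).symm

lemma card_pauliGroup : Nat.card pauliGroup = 16 := by
  rw [Nat.card_congr pauliEquiv.toEquiv, SemidirectProduct.card, Nat.card_prod]
  simp

instance : Finite pauliGroup := Nat.finite_of_card_ne_zero (by rw [card_pauliGroup]; norm_num)

noncomputable instance : Fintype pauliGroup := Fintype.ofFinite _

lemma pauliGroup_nonabelian : ∃ a b : pauliGroup, a * b ≠ b * a := by
  refine ⟨⟨pauliX, pauliX_mem⟩, ⟨pauliZ, pauliZ_mem⟩, fun h => ?_⟩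
  have := congrArg (fun g : pauliGroup => ((g : GL (Fin 2) ℂ) : Matrix (Fin 2) (Fin 2) ℂ) 0 1) h
  norm_num [coe_pauliX, coe_pauliZ] at this

lemma isPseudoreflection_of_sq {g : GL (Fin 2) ℂ} (hg : g ^ 2 = 1) (hne : g ≠ 1)
    (v w : Fin 2 → ℂ)
    (h : (g : Matrix (Fin 2) (Fin 2) ℂ) - 1 = Matrix.vecMulVec v w) : IsPseudoreflection g := by
  refine ⟨isOfFinOrder_iff_pow_eq_one.2 ⟨2, two_pos, hg⟩,
    le_antisymm (h ▸ Matrix.rank_vecMulVec_le v w) (Nat.one_le_iff_ne_zero.2 fun h0 => ?_)⟩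
  rw [Matrix.rank, Submodule.finrank_eq_zero, LinearMap.range_eq_bot,
    ← Matrix.toLin'_apply', LinearEquiv.map_eq_zero_iff, sub_eq_zero] at h0
  exact hne (Units.ext h0)

lemma closure_pseudoreflections_pauliGroup :
    Subgroup.closure {g | g ∈ pauliGroup ∧ IsPseudoreflection g} = pauliGroup := by
  refine le_antisymm ((Subgroup.closure_le _).2 fun g hg => hg.1) ?_
  refine Subgroup.closure_mono ?_
  have hne : ∀ g : GL (Fin 2) ℂ, (g : Matrix (Fin 2) (Fin 2) ℂ) 0 0 ≠ 1 ∨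
      (g : Matrix (Fin 2) (Fin 2) ℂ) 1 1 ≠ 1 → g ≠ 1 := by
    rintro _ h rfl
    simp at h
  rintro _ (rfl | rfl | rfl)
  · refine ⟨pauliX_mem, isPseudoreflection_of_sq pauliX_sq (hne _ (by simp [coe_pauliX]))
      ![-1, 1] ![1, -1] ?_⟩
    ext i j
    fin_cases i <;> fin_cases j <;> simp [coe_pauliX, Matrix.vecMulVec]
  · refine ⟨pauliY_mem, isPseudoreflection_of_sq pauliY_sq (hne _ (by simp [coe_pauliY]))
      ![-1, Complex.I] ![1, Complex.I] ?_⟩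
    ext i j
    fin_cases i <;> fin_cases j <;> simp [coe_pauliY, Matrix.vecMulVec]
  · refine ⟨pauliZ_mem, isPseudoreflection_of_sq pauliZ_sq (hne _ (by norm_num [coe_pauliZ]))
      ![0, -2] ![0, 1] ?_⟩
    ext i j
    fin_cases i <;> fin_cases j <;> norm_num [coe_pauliZ, Matrix.vecMulVec]

/-- The quotient map of `(C_4 × C_2) ⋊ C_2` to the Klein four-group. -/
def semidirectToKlein : (Cyc 4 × Cyc 2) ⋊[pauliTwist] Cyc 2 →* Cyc 2 × Cyc 2 where
  toFun p := (Multiplicative.ofAdd (p.left.1.toAdd.val : ZMod 2), p.right)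
  map_one' := rfl
  map_mul' := by
    have key : ∀ (a a' : Cyc 4) (b c : Cyc 2),
        (Multiplicative.ofAdd (((a * (pauliTwist b (a', c)).1).toAdd.val : ℕ) : ZMod 2) : Cyc 2) =
        Multiplicative.ofAdd (a.toAdd.val : ZMod 2) *
          Multiplicative.ofAdd (a'.toAdd.val : ZMod 2) := by decide
    rintro ⟨⟨a, c⟩, b⟩ ⟨⟨a', c'⟩, b'⟩
    exact Prod.ext (key a a' b c') rfl

/-- The inclusion of the kernel of `semidirectToKlein`. -/
def kleinToSemidirect : Cyc 2 × Cyc 2 →* (Cyc 4 × Cyc 2) ⋊[pauliTwist] Cyc 2 :=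
  SemidirectProduct.inl.comp
    { toFun := fun k => (Multiplicative.ofAdd ((2 * k.1.toAdd.val : ℕ) : ZMod 4), k.2)
      map_one' := rfl
      map_mul' := by decide }

/-- A quotient map of the Pauli group to the Klein four-group. -/
noncomputable def pauliToKlein : pauliGroup →* Cyc 2 × Cyc 2 :=
  semidirectToKlein.comp pauliEquiv.toMonoidHom

lemma pauliToKlein_surjective : Function.Surjective pauliToKlein := by
  refine Function.Surjective.comp (g := semidirectToKlein) ?_ pauliEquiv.surjective
  rintro ⟨s, b⟩
  refine ⟨⟨(Multiplicative.ofAdd (s.toAdd.val : ZMod 4), 1), b⟩, Prod.ext ?_ rfl⟩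
  change Multiplicative.ofAdd (((s.toAdd.val : ZMod 4).val : ℕ) : ZMod 2) = s
  revert s
  decide

/-- The kernel of `pauliToKlein` is a Klein four-group. -/
noncomputable def pauliKerEquiv : pauliToKlein.ker ≃* Cyc 2 × Cyc 2 :=
  (MulEquiv.ofBijective ((pauliEquiv.symm.toMonoidHom.comp kleinToSemidirect).codRestrict
      pauliToKlein.ker fun k => by
    rw [MonoidHom.mem_ker]
    simp only [pauliToKlein, MonoidHom.comp_apply, MulEquiv.coe_toMonoidHom,
      MulEquiv.apply_symm_apply]
    have : ∀ s : Cyc 2, (Multiplicative.ofAdd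
      ((((2 * s.toAdd.val : ℕ) : ZMod 4).val : ℕ) : ZMod 2) : Cyc 2) = 1 := by decide
    exact Prod.ext (this k.1) rfl) ⟨fun k l h => by
    have h1 : kleinToSemidirect k = kleinToSemidirect l :=
      pauliEquiv.symm.injective (congrArg Subtype.val h)
    have h2 := SemidirectProduct.inl_injective h1
    clear h h1
    revert k l
    decide, fun ⟨g, hg⟩ => by
    obtain ⟨p, rfl⟩ := pauliEquiv.symm.surjective g
    obtain ⟨⟨a, c⟩, b⟩ := p
    rw [MonoidHom.mem_ker] at hg
    simp only [pauliToKlein, MonoidHom.comp_apply, MulEquiv.coe_toMonoidHom,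
      MulEquiv.apply_symm_apply] at hg
    have hb : b = 1 := congrArg Prod.snd hg
    have ha : (Multiplicative.ofAdd (a.toAdd.val : ZMod 2) : Cyc 2) = 1 := congrArg Prod.fst hg
    have hex : ∀ a : Cyc 4, (Multiplicative.ofAdd (a.toAdd.val : ZMod 2) : Cyc 2) = 1 →
      ∃ s : Cyc 2, Multiplicative.ofAdd ((2 * s.toAdd.val : ℕ) : ZMod 4) = a := by decide
    obtain ⟨s, hs⟩ := hex a ha
    subst hb hs
    exact ⟨(s, c), rfl⟩⟩).symm

end PauliStructure

section OrbitSum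

variable {F : Type*} [Field F] {G : Type*} [Group G] [Fintype G] {n : ℕ} (ρ : G →* GL (Fin n) F)

lemma orbitSum_polyAct (g : G) (p : MvPolynomial (Fin n) F) :
    orbitSum ρ (polyAct ρ g p) = orbitSum ρ p := by
  simp only [orbitSum_apply, ← polyAct_mul]
  exact Fintype.sum_equiv (Equiv.mulRight g) _ _ fun _ => rfl

end OrbitSum

section PauliInvariants

lemma pauliX_inv : pauliX⁻¹ = pauliX := inv_eq_of_mul_eq_one_left (by rw [← pow_two, pauliX_sq])

lemma pauliY_inv : pauliY⁻¹ = pauliY := inv_eq_of_mul_eq_one_left (by rw [← pow_two, pauliY_sq])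

lemma pauliZ_inv : pauliZ⁻¹ = pauliZ := inv_eq_of_mul_eq_one_left (by rw [← pow_two, pauliZ_sq])

lemma pauliI_inv : pauliI⁻¹ = -pauliI :=
  inv_eq_of_mul_eq_one_left (by rw [neg_mul, ← pow_two, pauliI_sq, neg_neg])

lemma pauliGroup_closure_eq_top : Subgroup.closure
    {g : pauliGroup | (g : GL (Fin 2) ℂ) = pauliX ∨ (g : GL (Fin 2) ℂ) = pauliY ∨
      (g : GL (Fin 2) ℂ) = pauliZ} = ⊤ :=
  Subgroup.closure_closure_coe_preimage (k := {pauliX, pauliY, pauliZ})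

lemma polyAct_pauliRep_X (g : pauliGroup) (j : Fin 2) :
    polyAct pauliRep g (X j) =
      C (((g : GL (Fin 2) ℂ)⁻¹ : GL (Fin 2) ℂ) j 0) * X 0 +
      C (((g : GL (Fin 2) ℂ)⁻¹ : GL (Fin 2) ℂ) j 1) * X 1 := by
  rw [polyAct_X, Fin.sum_univ_two]
  rfl

/-- The first fundamental invariant `x⁴ + y⁴`. -/
noncomputable def pauliInvA : MvPolynomial (Fin 2) ℂ := X 0 ^ 4 + X 1 ^ 4

/-- The second fundamental invariant `x²y²`. -/
noncomputable def pauliInvB : MvPolynomial (Fin 2) ℂ := X 0 ^ 2 * X 1 ^ 2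

lemma C_I_mul_C_I : (C Complex.I * C Complex.I : MvPolynomial (Fin 2) ℂ) = -1 := by
  rw [← C_mul, Complex.I_mul_I]
  simp

lemma adjoin_le_invariantRing : Algebra.adjoin ℂ {pauliInvA, pauliInvB} ≤ invariantRing pauliRep := by
  have hI2 : (C Complex.I ^ 2 : MvPolynomial (Fin 2) ℂ) = -1 := by rw [pow_two, C_I_mul_C_I]
  have hI4 : (C Complex.I ^ 4 : MvPolynomial (Fin 2) ℂ) = 1 := by
    rw [show 4 = 2 * 2 from rfl, pow_mul, hI2]; ring
  have hn : ∀ p : MvPolynomial (Fin 2) ℂ, (-p) ^ 4 = p ^ 4 := fun p => by ring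
  refine Algebra.adjoin_le ?_
  rintro _ (rfl | rfl) <;>
    refine mem_invariantRing_of_closure _ pauliGroup_closure_eq_top ?_ <;>
    rintro g (h | h | h) <;>
    simp [pauliInvA, pauliInvB, polyAct_pauliRep_X, h, pauliX_inv, pauliY_inv, pauliZ_inv,
      coe_pauliX, coe_pauliY, coe_pauliZ, mul_pow, hI2, hI4, hn] <;> ring

lemma powSum_mem_adjoin (r : ℕ) : (X 0 ^ (4 * r) + X 1 ^ (4 * r) : MvPolynomial (Fin 2) ℂ) ∈
    Algebra.adjoin ℂ {pauliInvA, pauliInvB} := by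
  have hA : pauliInvA ∈ Algebra.adjoin ℂ {pauliInvA, pauliInvB} :=
    Algebra.subset_adjoin (by simp)
  have hB : pauliInvB ∈ Algebra.adjoin ℂ {pauliInvA, pauliInvB} :=
    Algebra.subset_adjoin (by simp)
  induction r using Nat.twoStepInduction with
  | zero =>
    rw [mul_zero, pow_zero, pow_zero]
    exact add_mem (one_mem _) (one_mem _)
  | one => exact hA
  | more r h1 h2 =>
    have : (X 0 ^ (4 * (r + 2)) + X 1 ^ (4 * (r + 2)) : MvPolynomial (Fin 2) ℂ) =
        pauliInvA * (X 0 ^ (4 * (r + 1)) + X 1 ^ (4 * (r + 1))) -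
          pauliInvB ^ 2 * (X 0 ^ (4 * r) + X 1 ^ (4 * r)) := by
      rw [pauliInvA, pauliInvB]
      ring
    rw [this]
    exact sub_mem (mul_mem hA h2) (mul_mem (pow_mem hB 2) h1)

lemma symm_monomial_mem_adjoin {a b : ℕ} (ha : 2 ∣ a) (hab : 4 ∣ a + b) :
    (X 0 ^ a * X 1 ^ b + X 0 ^ b * X 1 ^ a : MvPolynomial (Fin 2) ℂ) ∈
      Algebra.adjoin ℂ {pauliInvA, pauliInvB} := by
  wlog h : a ≤ b generalizing a b
  · rw [add_comm (X 0 ^ a * X 1 ^ b)]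
    exact this (by omega) (by omega) (by omega)
  obtain ⟨p, rfl⟩ := ha
  obtain ⟨r, rfl⟩ : ∃ r, b = 2 * p + 4 * r := ⟨(b - 2 * p) / 4, by omega⟩
  have : (X 0 ^ (2 * p) * X 1 ^ (2 * p + 4 * r) + X 0 ^ (2 * p + 4 * r) * X 1 ^ (2 * p) :
      MvPolynomial (Fin 2) ℂ) = pauliInvB ^ p * (X 0 ^ (4 * r) + X 1 ^ (4 * r)) := by
    rw [pauliInvB]
    ring
  rw [this]
  exact mul_mem (pow_mem (Algebra.subset_adjoin (by simp)) p) (powSum_mem_adjoin r)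

lemma orbitSum_pauli_monomial_mem (a b : ℕ) :
    orbitSum pauliRep (X 0 ^ a * X 1 ^ b) ∈ Algebra.adjoin ℂ {pauliInvA, pauliInvB} := by
  set p : MvPolynomial (Fin 2) ℂ := X 0 ^ a * X 1 ^ b with hp
  have hzero : ∀ c : ℂ, c ≠ 1 → ∀ g, polyAct pauliRep g p = C c * p → orbitSum pauliRep p = 0 := by
    intro c hc g hg
    have h1 := orbitSum_polyAct pauliRep g p
    rw [hg, ← smul_eq_C_mul, map_smul, ← sub_eq_zero] at h1
    nth_rewrite 2 [← one_smul ℂ (orbitSum pauliRep p)] at h1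
    rw [← sub_smul] at h1
    exact (smul_eq_zero.1 h1).resolve_left (sub_ne_zero.2 hc)
  have hZ : polyAct pauliRep ⟨pauliZ, pauliZ_mem⟩ p = C ((-1) ^ b) * p := by
    simp [hp, polyAct_pauliRep_X, pauliZ_inv, coe_pauliZ]
    rw [neg_pow]
    ring
  have hI : polyAct pauliRep ⟨pauliI, pauliI_mem⟩ p = C ((-Complex.I) ^ (a + b)) * p := by
    simp [hp, polyAct_pauliRep_X, pauliI_inv, coe_pauliI]
    rw [neg_pow, neg_pow (C Complex.I * X 1), neg_pow (C Complex.I), mul_pow, mul_pow]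
    ring
  by_cases hb : 2 ∣ b
  swap
  · have hodd : (-1 : ℂ) ^ b = -1 := Odd.neg_one_pow (Nat.not_even_iff_odd.1 fun h => hb h.two_dvd)
    rw [hodd] at hZ
    rw [hzero _ (by norm_num) _ hZ]
    exact zero_mem _
  by_cases hab : 4 ∣ a + b
  swap
  · have hne : (-Complex.I) ^ (a + b) ≠ 1 := by
      have h4 : (-Complex.I) ^ 4 = 1 := by
        rw [neg_pow, Complex.I_pow_four]; norm_num
      rw [pow_eq_pow_mod _ h4]
      have h : (a + b) % 4 = 1 ∨ (a + b) % 4 = 2 ∨ (a + b) % 4 = 3 := by omega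
      rcases h with h | h | h <;> rw [h]
      · intro hI; simpa using congrArg Complex.re hI
      · norm_num
      · intro hI
        rw [pow_succ, neg_sq, Complex.I_sq] at hI
        simpa using congrArg Complex.re hI
    rw [hzero _ hne _ hI]
    exact zero_mem _
  have hX : polyAct pauliRep ⟨pauliX, pauliX_mem⟩ p = X 0 ^ b * X 1 ^ a := by
    simp [hp, polyAct_pauliRep_X, pauliX_inv, coe_pauliX, mul_comm]
  have hmem := symm_monomial_mem_adjoin (a := a) (b := b) (by omega) hab
  have hsum := orbitSum_of_mem_invariantRing pauliRep (adjoin_le_invariantRing hmem)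
  rw [← hX, map_add, orbitSum_polyAct, ← two_smul ℂ] at hsum
  refine (Submodule.smul_mem_iff (Subalgebra.toSubmodule
    (Algebra.adjoin ℂ {pauliInvA, pauliInvB})) (two_ne_zero (α := ℂ))).1 ?_
  rw [hsum, hX]
  exact Submodule.smul_mem _ _ hmem

theorem invariantRing_pauliRep :
    invariantRing pauliRep = Algebra.adjoin ℂ {pauliInvA, pauliInvB} := by
  refine le_antisymm (fun f hf => ?_) adjoin_le_invariantRing
  have hsum := orbitSum_of_mem_invariantRing pauliRep hf
  have hne : (Fintype.card pauliGroup : ℂ) ≠ 0 := Nat.cast_ne_zero.2 Fintype.card_ne_zero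
  refine (Submodule.smul_mem_iff (Subalgebra.toSubmodule
    (Algebra.adjoin ℂ {pauliInvA, pauliInvB})) hne).1 ?_
  rw [← hsum, f.as_sum, map_sum]
  refine Submodule.sum_mem _ fun m _ => ?_
  rw [monomial_eq, Finsupp.prod_fintype _ _ (fun _ => pow_zero _), Fin.prod_univ_two,
    ← smul_eq_C_mul, map_smul]
  exact Submodule.smul_mem _ _ (orbitSum_pauli_monomial_mem _ _)

/-- The Hilbert ideal of the Pauli group is generated by the two fundamental invariants. -/
lemma posInvariants_pauliRep_le : posInvariants pauliRep ≤
    (Ideal.span {pauliInvA, pauliInvB}).restrictScalars ℂ := by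
  have key : ∀ f ∈ Algebra.adjoin ℂ {pauliInvA, pauliInvB},
      f - C (constantCoeff f) ∈ Ideal.span {pauliInvA, pauliInvB} := by
    intro f hf
    induction hf using Algebra.adjoin_induction with
    | mem f hf =>
      have h0 : constantCoeff f = 0 := by
        rcases hf with rfl | rfl <;> simp [pauliInvA, pauliInvB]
      rw [h0, C_0, sub_zero]
      exact Ideal.subset_span hf
    | algebraMap r => simp [algebraMap_eq]
    | add f g _ _ hf hg =>
      rw [map_add, C_add, add_sub_add_comm]
      exact add_mem hf hg
    | mul f g _ _ hf hg =>
      rw [map_mul, C_mul, show f * g - C (constantCoeff f) * C (constantCoeff g) =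
        (f - C (constantCoeff f)) * g + C (constantCoeff f) * (g - C (constantCoeff g)) by ring]
      exact add_mem (Ideal.mul_mem_right _ _ hf) (Ideal.mul_mem_left _ _ hg)
  refine Submodule.span_le.2 ?_
  rintro f ⟨hf, d, hd, hfd⟩
  have h0 : constantCoeff f = 0 := by
    rw [constantCoeff_eq]
    exact hfd.coeff_eq_zero (by simpa using hd.ne)
  have := key f (invariantRing_pauliRep ▸ hf)
  rwa [h0, C_0, sub_zero] at this

/-- A linear functional vanishing on the Hilbert ideal of the Pauli group. -/
lemma coeff_eq_of_mem_hilbertIdeal {f : MvPolynomial (Fin 2) ℂ}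
    (hf : f ∈ Ideal.span {pauliInvA, pauliInvB}) :
    f.coeff (Finsupp.single 0 5 + Finsupp.single 1 1) =
      f.coeff (Finsupp.single 0 1 + Finsupp.single 1 5) := by
  obtain ⟨u, v, rfl⟩ := Ideal.mem_span_pair.1 hf
  have e1 : (Finsupp.single 0 5 + Finsupp.single 1 1 - Finsupp.single 0 4 : Fin 2 →₀ ℕ) =
      Finsupp.single 0 1 + Finsupp.single 1 1 := by
    ext i; fin_cases i <;> simp
  have e2 : (Finsupp.single 0 1 + Finsupp.single 1 5 - Finsupp.single 1 4 : Fin 2 →₀ ℕ) =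
      Finsupp.single 0 1 + Finsupp.single 1 1 := by
    ext i; fin_cases i <;> simp
  have hB : pauliInvB = monomial (Finsupp.single 0 2 + Finsupp.single 1 2) 1 := by
    rw [pauliInvB, X_pow_eq_monomial, X_pow_eq_monomial, monomial_mul, one_mul]
  have hA : pauliInvA = monomial (Finsupp.single 0 4) 1 + monomial (Finsupp.single 1 4) 1 := by
    rw [pauliInvA, X_pow_eq_monomial, X_pow_eq_monomial]
  rw [hA, hB]
  simp [mul_add, coeff_mul_monomial', Finsupp.le_def, Fin.forall_fin_two, e1, e2]

lemma X0_pow_mul_X1_pow_eq (a b : ℕ) : (X 0 ^ a * X 1 ^ b : MvPolynomial (Fin 2) ℂ) =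
    monomial (Finsupp.single 0 a + Finsupp.single 1 b) 1 := by
  rw [X_pow_eq_monomial, X_pow_eq_monomial, monomial_mul, one_mul]

lemma single_add_single_ne :
    (Finsupp.single 0 5 + Finsupp.single 1 1 : Fin 2 →₀ ℕ) ≠
      Finsupp.single 0 1 + Finsupp.single 1 5 := fun h => by
  simpa using DFunLike.congr_fun h 0

theorem coinvariantDegreeOf_pauliRep : coinvariantDegreeOf 1 pauliRep = 6 := by
  refine le_antisymm (coinvariantDegreeOf_le_of_extension pauliRep (π := pauliToKlein)
    (ψ := pauliKerEquiv.toMonoidHom) pauliKerEquiv.injective) ?_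
  refine le_iSup₂_of_le 6 ⟨X 0 ^ 5 * X 1 ^ 1, (isHomogeneous_X_pow _ _).mul
    (isHomogeneous_X_pow _ _), fun h => ?_⟩ le_rfl
  rw [pow_one] at h
  have h' := coeff_eq_of_mem_hilbertIdeal (Ideal.span_le.2 posInvariants_pauliRep_le h)
  rw [X0_pow_mul_X1_pow_eq, coeff_monomial, coeff_monomial, if_pos rfl,
    if_neg single_add_single_ne] at h'
  exact one_ne_zero h'

end PauliInvariants

section PauliNoether

/-- The sum of the tautological representation of the Pauli group and its determinant. -/
noncomputable def pauliDetRep : pauliGroup →* GL (Fin 3) ℂ :=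
  MonoidHom.toHomUnits
    { toFun := fun g => !![(g : GL (Fin 2) ℂ) 0 0, (g : GL (Fin 2) ℂ) 0 1, 0;
        (g : GL (Fin 2) ℂ) 1 0, (g : GL (Fin 2) ℂ) 1 1, 0;
        0, 0, Matrix.det ((g : GL (Fin 2) ℂ) : Matrix (Fin 2) (Fin 2) ℂ)]
      map_one' := by
        ext i j
        fin_cases i <;> fin_cases j <;> simp
      map_mul' := fun g h => by
        ext i j
        fin_cases i <;> fin_cases j <;>
          simp [Matrix.mul_apply, Fin.sum_univ_three, Fin.sum_univ_two] }

lemma polyAct_pauliDetRep_X (g : pauliGroup) :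
    polyAct pauliDetRep g (X 0) = C (((g : GL (Fin 2) ℂ)⁻¹ : GL (Fin 2) ℂ) 0 0) * X 0 +
      C (((g : GL (Fin 2) ℂ)⁻¹ : GL (Fin 2) ℂ) 0 1) * X 1 ∧
    polyAct pauliDetRep g (X 1) = C (((g : GL (Fin 2) ℂ)⁻¹ : GL (Fin 2) ℂ) 1 0) * X 0 +
      C (((g : GL (Fin 2) ℂ)⁻¹ : GL (Fin 2) ℂ) 1 1) * X 1 ∧
    polyAct pauliDetRep g (X 2) =
      C (Matrix.det (((g : GL (Fin 2) ℂ)⁻¹ : GL (Fin 2) ℂ) : Matrix (Fin 2) (Fin 2) ℂ)) * X 2 := by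
  have hM : ∀ g : pauliGroup, ((pauliDetRep g : GL (Fin 3) ℂ) : Matrix (Fin 3) (Fin 3) ℂ) =
      !![(g : GL (Fin 2) ℂ) 0 0, (g : GL (Fin 2) ℂ) 0 1, 0;
        (g : GL (Fin 2) ℂ) 1 0, (g : GL (Fin 2) ℂ) 1 1, 0;
        0, 0, Matrix.det ((g : GL (Fin 2) ℂ) : Matrix (Fin 2) (Fin 2) ℂ)] := fun _ => rfl
  refine ⟨?_, ?_, ?_⟩ <;>
    rw [polyAct_X, Fin.sum_univ_three, hM, ← Subgroup.coe_inv] <;> simp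

/-- Setting the third variable to zero. -/
noncomputable def dropThird : MvPolynomial (Fin 3) ℂ →ₐ[ℂ] MvPolynomial (Fin 2) ℂ :=
  aeval ![X 0, X 1, 0]

lemma dropThird_polyAct (g : pauliGroup) (p : MvPolynomial (Fin 3) ℂ) :
    dropThird (polyAct pauliDetRep g p) = polyAct pauliRep g (dropThird p) := by
  suffices H : dropThird.comp (polyAct pauliDetRep g) = (polyAct pauliRep g).comp dropThird from
    DFunLike.congr_fun H p
  obtain ⟨h0, h1, h2⟩ := polyAct_pauliDetRep_X g
  refine MvPolynomial.algHom_ext fun j => ?_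
  simp only [AlgHom.comp_apply]
  fin_cases j
  · simp [h0, dropThird, polyAct_pauliRep_X, algebraMap_eq]
  · simp [h1, dropThird, polyAct_pauliRep_X, algebraMap_eq]
  · simp [h2, dropThird]

lemma dropThird_mem_posInvariants {p : MvPolynomial (Fin 3) ℂ} (hp : p ∈ posInvariants pauliDetRep) :
    dropThird p ∈ posInvariants pauliRep := by
  suffices posInvariants pauliDetRep ≤ (posInvariants pauliRep).comap dropThird.toLinearMap from
    this hp
  refine Submodule.span_le.2 ?_
  rintro p ⟨hp, d, hd, hpd⟩
  refine mem_posInvariants _ (fun g => ?_) hd ?_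
  · rw [AlgHom.toLinearMap_apply, ← dropThird_polyAct, hp g]
  · have := hpd.aeval (![X 0, X 1, 0] : Fin 3 → MvPolynomial (Fin 2) ℂ) (n := 1) fun j => by
      fin_cases j
      · exact isHomogeneous_X _ _
      · exact isHomogeneous_X _ _
      · exact isHomogeneous_zero _ _ _
    simpa [dropThird] using this

/-- The coefficient of the third variable of a decomposable invariant lies in the Hilbert ideal. -/
lemma dropThird_pderiv_mem {p : MvPolynomial (Fin 3) ℂ} (hp : p ∈ posInvariants pauliDetRep ^ 2) :
    dropThird (pderiv 2 p) ∈ Ideal.span {pauliInvA, pauliInvB} := by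
  rw [pow_two] at hp
  induction hp using Submodule.mul_induction_on' with
  | add a _ b _ ha hb =>
    rw [map_add, map_add]
    exact add_mem ha hb
  | mem_mul_mem a ha b hb =>
    rw [pderiv_mul, map_add, map_mul, map_mul]
    exact add_mem
      (Ideal.mul_mem_left _ _ (posInvariants_pauliRep_le (dropThird_mem_posInvariants hb)))
      (Ideal.mul_mem_right _ _ (posInvariants_pauliRep_le (dropThird_mem_posInvariants ha)))

lemma seven_le_noetherNumberOf_pauliDetRep : 7 ≤ noetherNumberOf 1 pauliDetRep := by
  let f : MvPolynomial (Fin 3) ℂ := (X 0 ^ 5 * X 1 ^ 1 - X 0 ^ 1 * X 1 ^ 5) * X 2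
  have hfd : f.IsHomogeneous 7 :=
    (((isHomogeneous_X_pow _ 5).mul (isHomogeneous_X_pow _ 1)).sub
      ((isHomogeneous_X_pow _ 1).mul (isHomogeneous_X_pow _ 5))).mul (isHomogeneous_X _ _)
  have hI2 : (C Complex.I ^ 2 : MvPolynomial (Fin 3) ℂ) = -1 := by
    rw [← C_pow, Complex.I_sq]; simp
  have hfinv : f ∈ invariantRing pauliDetRep := by
    refine mem_invariantRing_of_closure _ pauliGroup_closure_eq_top ?_
    intro g h
    obtain ⟨h0, h1, h2⟩ := polyAct_pauliDetRep_X g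
    simp only [f, map_mul, map_sub, map_pow, h0, h1, h2]
    rcases h with h | h | h
    · simp [h, pauliX_inv, coe_pauliX, Matrix.det_fin_two]
      ring
    · simp [h, pauliY_inv, coe_pauliY, Matrix.det_fin_two]
      linear_combination (-(X 0 : MvPolynomial (Fin 3) ℂ) ^ 5 * X 1 + X 0 * X 1 ^ 5) * X 2 *
        (C Complex.I ^ 4 - C Complex.I ^ 2 + 1) * hI2
    · simp [h, pauliZ_inv, coe_pauliZ, Matrix.det_fin_two]
      ring
  refine le_iSup₂_of_le 7 ⟨f, mem_posInvariants _ hfinv (by norm_num) hfd, hfd, fun hmem => ?_⟩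
    le_rfl
  have hD : dropThird (pderiv 2 f) = X 0 ^ 5 * X 1 ^ 1 - X 0 ^ 1 * X 1 ^ 5 := by
    simp [f, pderiv_X, dropThird]
  have h := coeff_eq_of_mem_hilbertIdeal (hD ▸ dropThird_pderiv_mem hmem)
  rw [X0_pow_mul_X1_pow_eq, X0_pow_mul_X1_pow_eq, coeff_sub, coeff_sub, coeff_monomial,
    coeff_monomial, coeff_monomial, coeff_monomial, if_pos rfl, if_pos rfl,
    if_neg single_add_single_ne, if_neg single_add_single_ne.symm] at h
  norm_num at h

theorem noetherNumber_pauliGroup : noetherNumber ℂ 1 pauliGroup = 7 :=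
  le_antisymm (iSup₂_le fun _ ρ => noetherNumberOf_le_of_extension ρ (π := pauliToKlein)
      (ψ := pauliKerEquiv.toMonoidHom) pauliKerEquiv.injective)
    (le_iSup₂_of_le 3 pauliDetRep seven_le_noetherNumberOf_pauliDetRep)

theorem coinvariantDegree_pauliGroup : coinvariantDegree ℂ 1 pauliGroup = 6 :=
  le_antisymm (iSup₂_le fun _ ρ => coinvariantDegreeOf_le_of_extension ρ (π := pauliToKlein)
      (ψ := pauliKerEquiv.toMonoidHom) pauliKerEquiv.injective)
    (le_iSup₂_of_le 2 pauliRep coinvariantDegreeOf_pauliRep.ge)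

end PauliNoether

theorem mainTheorem12 :
    -- the group `G`: order, pseudoreflection group, group structure
    Nat.card pauliGroup = 16 ∧
    Subgroup.closure {g | g ∈ pauliGroup ∧ IsPseudoreflection g} = pauliGroup ∧
    (∃ a b : pauliGroup, a * b ≠ b * a) ∧
    (∃ φ : Cyc 2 →* MulAut (Cyc 4 × Cyc 2),
      Nonempty (pauliGroup ≃* (Cyc 4 × Cyc 2) ⋊[φ] Cyc 2)) ∧
    (∃ (N : Subgroup pauliGroup) (_ : N.Normal),
      Nonempty (N ≃* Cyc 2 × Cyc 2) ∧ Nonempty (pauliGroup ⧸ N ≃* Cyc 2 × Cyc 2)) ∧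
    -- the invariants on `V = ℂ²`, and the lower bound
    invariantRing pauliRep =
      Algebra.adjoin ℂ {(MvPolynomial.X 0 ^ 4 + MvPolynomial.X 1 ^ 4 : MvPolynomial (Fin 2) ℂ),
        MvPolynomial.X 0 ^ 2 * MvPolynomial.X 1 ^ 2} ∧
    coinvariantDegreeOf 1 pauliRep = 6 ∧
    noetherNumber ℂ 1 pauliGroup = coinvariantDegree ℂ 1 pauliGroup + 1 ∧
    coinvariantDegreeOf 1 pauliRep + 1 ≤ noetherNumber ℂ 1 pauliGroup ∧
    -- the upper bound
    noetherNumber ℂ 1 (Cyc 2 × Cyc 2) = 3 ∧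
    noetherNumber ℂ 1 pauliGroup ≤ noetherNumber ℂ 3 (Cyc 2 × Cyc 2) ∧
    noetherNumber ℂ 3 (Cyc 2 × Cyc 2) = davenport 3 (Cyc 2 × Cyc 2) ∧
    davenport 3 (Cyc 2 × Cyc 2) = 7 ∧
    -- the Noether number
    noetherNumber ℂ 1 pauliGroup = 7 := by
  have h67 : (6 + 1 : ℕ∞) = 7 := by norm_num
  have hD : davenport 3 (Cyc 2 × Cyc 2) = 7 := davenport_klein (by norm_num)
  have hN : noetherNumber ℂ 3 (Cyc 2 × Cyc 2) = 7 := noetherNumber_klein (by norm_num)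
  refine ⟨card_pauliGroup, closure_pseudoreflections_pauliGroup, pauliGroup_nonabelian,
    ⟨pauliTwist, ⟨pauliEquiv⟩⟩,
    ⟨pauliToKlein.ker, inferInstance, ⟨pauliKerEquiv⟩,
      ⟨QuotientGroup.quotientKerEquivOfSurjective _ pauliToKlein_surjective⟩⟩,
    invariantRing_pauliRep, coinvariantDegreeOf_pauliRep, ?_, ?_,
    noetherNumber_klein (by norm_num), ?_, hN.trans hD.symm, hD, noetherNumber_pauliGroup⟩
  · rw [noetherNumber_pauliGroup, coinvariantDegree_pauliGroup, h67]
  · rw [noetherNumber_pauliGroup, coinvariantDegreeOf_pauliRep, h67]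
  · rw [noetherNumber_pauliGroup, hN]
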